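/- Let $0\le p<q$ be integers, let $a=(a_1,\dots,a_p)$ and $b=(b_1,\dots,b_q)$ be vectors of rational numbers, all entries greater than $-1$, with $a_j<b_j$ for $1\le j\le p$, and let $z$ be a nonzero rational number. Suppose that $a_i-b_j\notin\mathbb{Z}_{\ge 0}$ for all $1\le i\le p$, $1\le j\le q$ with $i\ne j$, and $b_i-b_j\notin\mathbb{Z}_{\ge 0}$ for all $1\le i,j\le q$ with $i\neq j$. Write $(x)_k=x(x+1)\cdots(x+k-1)$, $(a+1)_k=\prod_{i=1}^p(a_i+1)_k$ and $(b+1)_k=\prod_{i=1}^q(b_i+1)_k$ (empty products are $1$). Then the $q$ series $$ \sum_{k\ge 0}\frac{(a+1)_k}{(b+1)_k\,\prod_{i=1}^{j}(b_i+k+1)}\,z^k,\qquad j=1,\dots,q, $$ converge absolutely, and the number $1$ together with their $q$ sums is linearly independent over $\mathbb{Q}$ (as a family of $q+1$ real numbers). In particular, each of these sums is irrational. -/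

import Mathlib

/-- The product `(v + 1)_k = ∏ i, (v i + 1)_k` of rising factorials attached to a vector `v`. -/
noncomputable def vecPochhammer {r : ℕ} (v : Fin r → ℚ) (k : ℕ) : ℝ :=
  ∏ i, (ascPochhammer ℝ k).eval ((v i : ℝ) + 1)

/-- The `k`-th term `(a + 1)_k / ((b + 1)_k ∏_{i ≤ j} (b i + k + 1)) * z ^ k`.
The index `j : Fin q` counts from zero, and the product over `i ≤ j` includes `i = j`. -/
noncomputable def hyperTerm {p q : ℕ} (a : Fin p → ℚ) (b : Fin q → ℚ) (z : ℚ) (j : Fin q)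
    (k : ℕ) : ℝ :=
  vecPochhammer a k / (vecPochhammer b k * ∏ i ∈ Finset.Iic j, ((b i : ℝ) + k + 1)) * (z : ℝ) ^ k

/-- The sum over `k ≥ 0` of the terms `hyperTerm a b z j k`. -/
noncomputable def hyperConst {p q : ℕ} (a : Fin p → ℚ) (b : Fin q → ℚ) (z : ℚ) (j : Fin q) : ℝ :=
  ∑' k : ℕ, hyperTerm a b z j k

/-! The proof uses Hermite–Padé approximation of type II. Put α = a + 1, β = b + 1, w = 1/z, and let
L_j send X^k to the coefficient of z^k in the j-th series f_j. For every polynomial Q, the number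
Q(w)·z·f_j − L_j((Q − Q(w))/(X − w)) equals Σ_m L_j(X^m Q) z^(m+1). It is therefore small when Q is
orthogonal to many powers of X.

The explicit polynomials `approxPoly` have degree N and satisfy L_j(X^m Q_N) = 0 whenever qm + j < N
(`momentFunctional_eq_zero`), because the pairing is an N-th difference of a polynomial of degree
less than N. For N between qn and q(n + 1) the remainder is at most K^(n+1) n!^p
(`exists_remainder_bound`). A common multiplier D_n of order at most K^(n+1)/n!^q makes the values
of the approximants integral (`exists_denominator`). An integral relation between 1 and the z·f_j
thus yields integers of size C^n/n!^(q−p), which are eventually 0.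

To exclude a nontrivial relation, the pairing must not vanish at qm + j = N
(`momentFunctional_ne_zero`); this is where the condition on α_i − β_j enters. Then q + 1
consecutive approximants have an invertible matrix of values (`eq_zero_of_approximants`), so the
relation is trivial. -/

open Polynomial

/-! ### Divided differences and independence of consecutive approximants -/

/-- The linear map `P ↦ (P - P(w)) / (X - w)` on polynomials. -/
noncomputable def dividedDiff (w : ℝ) : ℝ[X] →ₗ[ℝ] ℝ[X] :=
  Polynomial.lsum fun l => LinearMap.toSpanSingleton ℝ ℝ[X]
    (∑ k ∈ Finset.range l, X ^ k * C w ^ (l - 1 - k))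

theorem dividedDiff_X_pow (w : ℝ) (l : ℕ) :
    dividedDiff w (X ^ l) = ∑ k ∈ Finset.range l, X ^ k * C w ^ (l - 1 - k) := by
  simp [dividedDiff, Polynomial.lsum_apply, ← monomial_one_right_eq_X_pow, sum_monomial_index]

theorem dividedDiff_mul (w : ℝ) (P : ℝ[X]) :
    dividedDiff w P * (X - C w) = P - C (P.eval w) := by
  induction P using Polynomial.induction_on' with
  | add P Q hP hQ => rw [map_add, add_mul, hP, hQ, eval_add, C_add]; ring
  | monomial l c =>
    rw [← smul_X_eq_monomial, map_smul,
      dividedDiff_X_pow, smul_mul_assoc, Commute.geom_sum₂_mul (Commute.all _ _)]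
    simp [smul_eq_C_mul, mul_sub]

/-- The functional `P ↦ L_j (X ^ m * P)`, where `t = q * m + j`. -/
noncomputable def stepFunctional {q : ℕ} (hq : 0 < q) (L : Fin q → ℝ[X] →ₗ[ℝ] ℝ) (t : ℕ) :
    ℝ[X] →ₗ[ℝ] ℝ :=
  L ⟨t % q, Nat.mod_lt t hq⟩ ∘ₗ LinearMap.mulLeft ℝ (X ^ (t / q))

/-- A polynomial of degree `< M` killed by the first `M` functionals of a system biorthogonal in the
triangular sense to polynomials of each degree vanishes. -/
theorem eq_zero_of_triangular (ℓ : ℕ → ℝ[X] →ₗ[ℝ] ℝ) (Q : ℕ → ℝ[X])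
    (hdeg : ∀ N, (Q N).degree = N) (hzero : ∀ N t, t < N → ℓ t (Q N) = 0)
    (hne : ∀ N, ℓ N (Q N) ≠ 0) (M : ℕ) (A : ℝ[X]) (hA : A.degree < M)
    (h : ∀ t < M, ℓ t A = 0) : A = 0 := by
  have hspan : ∀ (M : ℕ) (A : ℝ[X]), A.degree < M → ∃ c : ℕ → ℝ,
      A = ∑ N ∈ Finset.range M, c N • Q N := by
    intro M
    induction M with
    | zero =>
      intro A hA
      exact ⟨0, by simpa [Polynomial.degree_lt_iff_coeff_zero, Polynomial.ext_iff] using hA⟩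
    | succ M ih =>
      intro A hA
      have hlead : (Q M).coeff M ≠ 0 := coeff_ne_zero_of_eq_degree (hdeg M)
      obtain ⟨c, hc⟩ := ih (A - (A.coeff M / (Q M).coeff M) • Q M) (by
        rw [degree_lt_iff_coeff_zero] at hA ⊢
        intro k hk
        rcases Nat.eq_or_lt_of_le hk with rfl | hk
        · simp [hlead]
        · have : (Q M).coeff k = 0 := coeff_eq_zero_of_degree_lt (by
            rw [hdeg M]; exact_mod_cast hk)
          simp [hA k hk, this])
      refine ⟨Function.update c M (A.coeff M / (Q M).coeff M), ?_⟩
      rw [Finset.sum_range_succ, Function.update_self]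
      rw [sub_eq_iff_eq_add] at hc
      nth_rewrite 1 [hc]
      congr 1
      refine Finset.sum_congr rfl fun N hN => ?_
      rw [Function.update_of_ne (Finset.mem_range.1 hN).ne]
  obtain ⟨c, rfl⟩ := hspan M A hA
  -- Applying `ℓ t` kills the terms with N > t by `hzero` and those with N < t by induction; only c
  -- t · ℓ_t(Q_t) remains.
  have hc : ∀ t, t < M → c t = 0 := by
    intro t
    induction t using Nat.strong_induction_on with
    | _ t ih =>
      intro ht
      have h1 := h t ht
      rw [map_sum, Finset.sum_eq_single t] at h1
      · simpa [hne t] using h1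
      · intro N hN hNt
        rcases lt_or_gt_of_ne hNt with hlt | hlt
        · simp [ih N hlt (Finset.mem_range.1 hN)]
        · simp [hzero N t hlt]
      · intro hn; exact absurd (Finset.mem_range.2 ht) hn
  exact Finset.sum_eq_zero fun N hN => by simp [hc N (Finset.mem_range.1 hN)]

/-- For a normal system on the step line, the values at `w` of `q + 1` consecutive simultaneous
approximants do not all lie in a common hyperplane. -/
theorem eq_zero_of_approximants {q : ℕ} (hq : 0 < q) (L : Fin q → ℝ[X] →ₗ[ℝ] ℝ) (Q : ℕ → ℝ[X])
    (hdeg : ∀ N, (Q N).degree = N)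
    (hzero : ∀ N t, t < N → stepFunctional hq L t (Q N) = 0)
    (hne : ∀ N, stepFunctional hq L N (Q N) ≠ 0) (w : ℝ) (n : ℕ) (c : Fin (q + 1) → ℝ)
    (h : ∀ s : Fin (q + 1), c 0 * (Q (q * n + s)).eval w +
      ∑ j, c j.succ * L j (dividedDiff w (Q (q * n + s))) = 0) : c = 0 := by
  by_contra hc
  let A : Matrix (Fin (q + 1)) (Fin (q + 1)) ℝ := fun s => Fin.cons ((Q (q * n + s)).eval w)
    fun j => L j (dividedDiff w (Q (q * n + s)))
  have hdet : A.det = 0 := Matrix.exists_mulVec_eq_zero_iff.1 ⟨c, hc, by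
    ext s
    simp only [Matrix.mulVec, dotProduct, Fin.sum_univ_succ, A, Fin.cons_zero, Fin.cons_succ,
      Pi.zero_apply]
    simpa only [mul_comm] using h s⟩
  -- A left null vector combines the approximants into one P with P(w) = 0 and L_j(P/(X − w)) = 0
  -- for all j.
  obtain ⟨μ, hμ, hA⟩ := Matrix.exists_vecMul_eq_zero_iff.2 hdet
  have hcol : ∀ j, ∑ s, μ s * A s j = 0 := fun j => congr_fun hA j
  set P : ℝ[X] := ∑ s, μ s • Q (q * n + s) with hP
  have hev : P.eval w = 0 := by
    simpa [A, P, eval_finsetSum] using hcol 0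
  have hLP : ∀ j, L j (dividedDiff w P) = 0 := fun j => by
    simpa [A, P] using hcol j.succ
  have hPdd : dividedDiff w P * (X - C w) = P := by
    rw [dividedDiff_mul, hev]; simp
  have horth : ∀ j m, m < n → L j (X ^ m * P) = 0 := by
    intro j m hm
    rw [hP, Finset.mul_sum, map_sum]
    refine Finset.sum_eq_zero fun s _ => ?_
    have := hzero (q * n + s) (q * m + j) (by nlinarith [j.2])
    have h1 : (q * m + (j : ℕ)) / q = m := by
      rw [Nat.mul_add_div hq, Nat.div_eq_of_lt j.2, add_zero]
    have h2 : (q * m + (j : ℕ)) % q = j := by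
      rw [Nat.mul_add_mod, Nat.mod_eq_of_lt j.2]
    simp only [stepFunctional, h1, h2, LinearMap.comp_apply, LinearMap.mulLeft_apply] at this
    rw [mul_smul_comm, map_smul, this, smul_zero]
  -- The quotient P/(X − w) gains one orthogonality relation per j over P, by X^(m+1) R = w X^m R +
  -- X^m P for R = P/(X − w). This gives q(n + 1) conditions on a polynomial of degree less than q(n
  -- + 1).
  have horth' : ∀ j m, m ≤ n → L j (X ^ m * dividedDiff w P) = 0 := by
    intro j m
    induction m with
    | zero => intro _; simpa using hLP j
    | succ m ih =>
      intro hm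
      have h1 := horth j m hm
      rw [← hPdd, show X ^ m * (dividedDiff w P * (X - C w)) =
        X ^ (m + 1) * dividedDiff w P - w • (X ^ m * dividedDiff w P) by
          rw [smul_eq_C_mul]; ring, map_sub, map_smul, ih (by omega), smul_zero, sub_zero] at h1
      exact h1
  have hPdeg : P.degree < ((q * (n + 1) + 1 : ℕ) : WithBot ℕ) := by
    refine lt_of_le_of_lt (degree_sum_le _ _)
      ((Finset.sup_lt_iff (WithBot.bot_lt_coe _)).2 fun s _ => ?_)
    refine lt_of_le_of_lt (degree_smul_le _ _) ?_
    rw [hdeg]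
    exact_mod_cast (by nlinarith [s.2] : q * n + (s : ℕ) < q * (n + 1) + 1)
  have hdd0 : dividedDiff w P = 0 := by
    refine eq_zero_of_triangular (stepFunctional hq L) Q hdeg hzero hne (q * (n + 1)) _ ?_ ?_
    · by_contra hge
      rw [not_lt] at hge
      rw [← hPdd, degree_mul, degree_X_sub_C] at hPdeg
      have : ((q * (n + 1) + 1 : ℕ) : WithBot ℕ) ≤ (dividedDiff w P).degree + 1 := by
        push_cast; gcongr; exact_mod_cast hge
      exact absurd hPdeg (not_lt.2 this)
    · intro t ht
      refine horth' _ _ ?_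
      have := Nat.div_lt_of_lt_mul ht
      omega
  have hP0 : P = 0 := by rw [← hPdd, hdd0, zero_mul]
  have hli : LinearIndependent ℝ fun s : Fin (q + 1) => Q (q * n + s) := by
    let S : Polynomial.Sequence ℝ := ⟨Q, hdeg⟩
    exact S.linearIndependent.comp (fun s : Fin (q + 1) => q * n + (s : ℕ))
      fun s t hst => Fin.ext (by simpa using hst)
  exact hμ (funext (Fintype.linearIndependent_iff.1 hli μ hP0))

/-! ### Rising factorials -/

/-- The rising factorial `(x)_k` of a real number. -/
noncomputable def risingFac (x : ℝ) (k : ℕ) : ℝ := (ascPochhammer ℝ k).eval x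

@[simp] theorem risingFac_zero (x : ℝ) : risingFac x 0 = 1 := by simp [risingFac]

theorem risingFac_succ (x : ℝ) (k : ℕ) : risingFac x (k + 1) = risingFac x k * (x + k) :=
  ascPochhammer_succ_eval k x

theorem risingFac_pos {x : ℝ} (hx : 0 < x) (k : ℕ) : 0 < risingFac x k :=
  ascPochhammer_pos k x hx

theorem risingFac_add (x : ℝ) (m n : ℕ) :
    risingFac x (m + n) = risingFac x m * risingFac (x + m) n := by
  induction n with
  | zero => simp
  | succ n ih => rw [← add_assoc, risingFac_succ, ih, risingFac_succ]; push_cast; ring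

theorem risingFac_succ_left (x : ℝ) (k : ℕ) :
    risingFac x (k + 1) = x * risingFac (x + 1) k := by
  have h1 : risingFac x 1 = x := by simpa using risingFac_succ x 0
  rw [add_comm, risingFac_add, h1]; simp

theorem risingFac_eq_prod (x : ℝ) (k : ℕ) : risingFac x k = ∏ s ∈ Finset.range k, (x + s) := by
  induction k with
  | zero => simp
  | succ k ih => rw [risingFac_succ, ih, Finset.prod_range_succ]

/-- Rising factorials are comparable with factorials up to an exponential factor. -/
theorem exists_risingFac_bound {x : ℝ} (hx : 0 < x) : ∃ c : ℝ, 1 ≤ c ∧ ∀ K, c ≤ K → ∀ k : ℕ,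
    risingFac x k ≤ K ^ k * k.factorial ∧ (k.factorial : ℝ) ≤ K ^ k * risingFac x k := by
  refine ⟨max 1 (max x x⁻¹), le_max_left _ _, fun K hK k => ?_⟩
  have h1 : 1 ≤ K := (le_max_left _ _).trans hK
  have h2 : x ≤ K := ((le_max_left _ _).trans (le_max_right _ _)).trans hK
  have h3 : 1 ≤ K * x := by
    have : x⁻¹ ≤ K := ((le_max_right _ _).trans (le_max_right _ _)).trans hK
    rwa [inv_le_iff_one_le_mul₀ hx] at this
  induction k with
  | zero => simp
  | succ k ih =>
    have hk : (0 : ℝ) ≤ k := k.cast_nonneg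
    have hp := risingFac_pos hx k
    have hK0 : 0 < K := by linarith
    rw [risingFac_succ, Nat.factorial_succ]
    push_cast
    constructor
    · calc risingFac x k * (x + k) ≤ (K ^ k * k.factorial) * (K * (k + 1)) := by
            gcongr
            · exact ih.1
            · nlinarith
        _ = _ := by ring
    · calc ((k : ℝ) + 1) * k.factorial ≤ (K * (x + k)) * (K ^ k * risingFac x k) := by
            gcongr
            · nlinarith
            · exact ih.2
        _ = _ := by ring

/-! ### Finite differences -/

theorem alternating_sum_eq_fwdDiff (f : ℝ → ℝ) (N : ℕ) (x : ℝ) :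
    ∑ l ∈ Finset.range (N + 1), (-1) ^ l * (N.choose l : ℝ) * f (x + l) =
      (-1) ^ N * (fwdDiff 1)^[N] f x := by
  rw [fwdDiff_iter_eq_sum_shift, Finset.mul_sum]
  refine Finset.sum_congr rfl fun l hl => ?_
  obtain ⟨k, rfl⟩ := Nat.exists_eq_add_of_le (Nat.lt_succ_iff.1 (Finset.mem_range.1 hl))
  have : (-1 : ℝ) ^ k * (-1) ^ k = 1 := by rw [← mul_pow]; simp
  simp only [Nat.add_sub_cancel_left, zsmul_eq_mul, nsmul_eq_mul, mul_one]
  push_cast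
  rw [pow_add]
  linear_combination -((-1) ^ l * (l + k).choose l * f (x + l)) * this

theorem alternating_sum_polynomial {H : ℝ[X]} {N : ℕ} (hH : H.degree < N) :
    ∑ l ∈ Finset.range (N + 1), (-1) ^ l * (N.choose l : ℝ) * H.eval (l : ℝ) = 0 := by
  rcases eq_or_ne H 0 with rfl | h0
  · simp
  have h := alternating_sum_eq_fwdDiff H.eval N 0
  simp only [zero_add] at h
  rw [h, Polynomial.fwdDiff_iter_eq_zero_of_degree_lt ((natDegree_lt_iff_degree_lt h0).2 hH)]
  simp

theorem fwdDiff_iter_inv (N : ℕ) {x : ℝ} (hx : 0 < x) :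
    (fwdDiff 1)^[N] (fun y : ℝ => y⁻¹) x = (-1) ^ N * N.factorial / risingFac x (N + 1) := by
  induction N generalizing x with
  | zero => simp [risingFac_succ]
  | succ N ih =>
    rw [Function.iterate_succ_apply', fwdDiff, ih (by positivity), ih hx,
      risingFac_succ (x + 1), risingFac_succ_left x (N + 1), risingFac_succ_left x N,
      risingFac_succ (x + 1), Nat.factorial_succ]
    have := (risingFac_pos (by positivity : 0 < x + 1) N).ne'
    have h2 : x + 1 + (N : ℝ) ≠ 0 := by positivity
    push_cast
    field_simp
    ring

theorem alternating_sum_inv (N : ℕ) {x : ℝ} (hx : 0 < x) :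
    ∑ l ∈ Finset.range (N + 1), (-1) ^ l * (N.choose l : ℝ) * (x + l)⁻¹ =
      N.factorial / risingFac x (N + 1) := by
  rw [alternating_sum_eq_fwdDiff (fun y => y⁻¹), fwdDiff_iter_inv N hx, mul_div_assoc, ← mul_assoc,
    ← mul_pow]
  simp

/-- The alternating binomial sum of `G(l) / (x + l)` depends only on `G(-x)` if `deg G ≤ N`. -/
theorem alternating_sum_polynomial_div {G : ℝ[X]} {N : ℕ} (hG : G.natDegree ≤ N) {x : ℝ}
    (hx : 0 < x) :
    ∑ l ∈ Finset.range (N + 1), (-1) ^ l * (N.choose l : ℝ) * (G.eval (l : ℝ) / (x + l)) =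
      G.eval (-x) * (N.factorial / risingFac x (N + 1)) := by
  have hdeg : (G /ₘ (X - C (-x))).degree < N := by
    rcases eq_or_ne G 0 with rfl | h0
    · simp
    · refine lt_of_lt_of_le (degree_divByMonic_lt _ _ h0 (by rw [degree_X_sub_C]; exact one_pos)) ?_
      exact natDegree_le_iff_degree_le.1 hG
  have key : ∀ l : ℕ, G.eval (l : ℝ) / (x + l) =
      (G /ₘ (X - C (-x))).eval (l : ℝ) + G.eval (-x) * (x + l)⁻¹ := by
    intro l
    have h := congr_arg (Polynomial.eval (l : ℝ)) (modByMonic_add_div G (X - C (-x)))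
    rw [modByMonic_X_sub_C_eq_C_eval] at h
    simp only [eval_add, eval_C, eval_mul, eval_sub, eval_X] at h
    have : x + (l : ℝ) ≠ 0 := by positivity
    rw [← h]
    field_simp
    ring
  simp_rw [key, mul_add, Finset.sum_add_distrib]
  rw [alternating_sum_polynomial hdeg, zero_add, ← alternating_sum_inv N hx, Finset.mul_sum]
  exact Finset.sum_congr rfl fun l _ => by ring

/-- The polynomial `l ↦ (l + c)_m`. -/
theorem exists_polynomial_prod_risingFac {ι : Type*} (s : Finset ι) (c : ι → ℝ) (m : ι → ℕ) :
    ∃ G : ℝ[X], G.natDegree ≤ ∑ i ∈ s, m i ∧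
      ∀ x : ℝ, G.eval x = ∏ i ∈ s, risingFac (c i + x) (m i) := by
  refine ⟨∏ i ∈ s, (ascPochhammer ℝ (m i)).comp (X + C (c i)), ?_, fun x => ?_⟩
  · refine (natDegree_prod_le _ _).trans (Finset.sum_le_sum fun i _ => ?_)
    rw [natDegree_comp, ascPochhammer_natDegree, natDegree_X_add_C, mul_one]
  · simp [eval_prod, risingFac, add_comm]

/-! ### Denominators -/

/-- The subring of integers in `ℝ`. -/
noncomputable abbrev intSubring : Subring ℝ := (Int.castRingHom ℝ).range

theorem intCast_mem_intSubring (m : ℤ) : (m : ℝ) ∈ intSubring := ⟨m, rfl⟩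

theorem natCast_mem_intSubring (m : ℕ) : (m : ℝ) ∈ intSubring := ⟨m, by simp⟩

/-- Argue one prime P at a time. If P divides d, then d^M suffices, since the exponent of P in M! is
at most M. Otherwise d is invertible modulo P^e and the progression becomes, up to a unit, M
consecutive integers. -/
theorem factorial_dvd_prod_arith (x d M : ℕ) :
    M.factorial ∣ d ^ M * ∏ s ∈ Finset.range M, (x + d * s) := by
  rw [Nat.dvd_iff_prime_pow_dvd_dvd]
  intro P e hP hdvd
  by_cases hPd : P ∣ d
  · have he : e ≤ M := by
      have := Fact.mk hP
      rcases eq_or_ne M 0 with rfl | hM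
      · rw [Nat.factorial_zero, Nat.dvd_one, Nat.pow_eq_one] at hdvd
        rcases hdvd with h | h
        · exact absurd h hP.one_lt.ne'
        · exact h.le
      · have h1 := sub_one_mul_padicValNat_factorial_lt_of_ne_zero P hM
        have h2 : e ≤ padicValNat P M.factorial :=
          (padicValNat_dvd_iff_le (Nat.factorial_ne_zero M)).1 hdvd
        have h3 : 1 ≤ P - 1 := by have := hP.two_le; omega
        nlinarith
    exact Dvd.dvd.mul_right ((pow_dvd_pow P he).trans (pow_dvd_pow_of_dvd hPd M)) _
  · have hcop : Nat.Coprime d (P ^ e) := ((hP.coprime_iff_not_dvd.2 hPd).pow_left e).symm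
    refine Dvd.dvd.mul_left ?_ _
    have hu : IsUnit (d : ZMod (P ^ e)) := (ZMod.isUnit_iff_coprime d (P ^ e)).2 hcop
    obtain ⟨v, hv⟩ := hu.exists_right_inv
    have : NeZero (P ^ e) := ⟨pow_ne_zero _ hP.ne_zero⟩
    obtain ⟨y, hy⟩ : ∃ y : ℕ, (y : ZMod (P ^ e)) = v * x :=
      ⟨(v * x).val, ZMod.natCast_zmod_val _⟩
    have h1 : ((y.ascFactorial M : ℕ) : ZMod (P ^ e)) = 0 := by
      rw [ZMod.natCast_eq_zero_iff]
      exact hdvd.trans (Nat.factorial_dvd_ascFactorial y M)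
    rw [← ZMod.natCast_eq_zero_iff]
    rw [Nat.ascFactorial_eq_prod_range] at h1
    push_cast at h1 ⊢
    have h2 : ∀ s ∈ Finset.range M, ((x : ZMod (P ^ e)) + d * s) = d * (y + s) := by
      intro s _
      rw [hy, mul_add, ← mul_assoc, hv, one_mul]
    rw [Finset.prod_congr rfl h2, Finset.prod_mul_distrib, h1, mul_zero]

theorem pow_mul_risingFac_div_factorial_mem {x : ℝ} {d x₀ : ℕ} (hx : d * x = x₀)
    (M : ℕ) : (d : ℝ) ^ (2 * M) * risingFac x M / M.factorial ∈ intSubring := by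
  obtain ⟨c, hc⟩ := factorial_dvd_prod_arith x₀ d M
  have h1 : (d : ℝ) ^ M * risingFac x M = ∏ s ∈ Finset.range M, ((x₀ : ℝ) + d * s) := by
    rw [risingFac_eq_prod, ← hx]
    nth_rewrite 1 [← Finset.card_range M]
    rw [← Finset.prod_const, ← Finset.prod_mul_distrib]
    exact Finset.prod_congr rfl fun s _ => by ring
  have h2 := congr_arg (Nat.cast (R := ℝ)) hc
  push_cast at h2
  have h3 : (d : ℝ) ^ (2 * M) * risingFac x M / M.factorial = c := by
    rw [two_mul, pow_add, mul_assoc, h1, h2]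
    field_simp
  rw [h3]
  exact natCast_mem_intSubring c

/-- Partial fractions write M!/(x)_(M+1) as an integral combination of the 1/(x + l) = d/(x₀ + dl),
whose denominators are at most Y. The lcm costs only an exponential factor. -/
theorem factorial_mul_lcmUpto_div_risingFac_mem {x : ℝ} {d x₀ Y : ℕ} (hd : 0 < d) (hx₀ : 0 < x₀)
    (hx : d * x = x₀) (M : ℕ) (hY : x₀ + d * M ≤ Y) :
    (M.factorial : ℝ) * Nat.lcmUpto Y / risingFac x (M + 1) ∈ intSubring := by
  have hd' : (0 : ℝ) < d := by exact_mod_cast hd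
  have hxpos : 0 < x := by
    have : (0 : ℝ) < d * x := by rw [hx]; exact_mod_cast hx₀
    exact pos_of_mul_pos_right this hd'.le
  rw [mul_div_right_comm, ← alternating_sum_inv M hxpos, Finset.sum_mul]
  refine sum_mem fun l hl => ?_
  rw [mul_assoc]
  refine mul_mem (mul_mem (pow_mem (neg_mem (one_mem _)) _) (natCast_mem_intSubring _)) ?_
  have hl' : l ≤ M := Nat.lt_succ_iff.1 (Finset.mem_range.1 hl)
  have hdvd : x₀ + d * l ∣ Nat.lcmUpto Y :=
    Finset.dvd_lcm (f := id) (Finset.mem_Icc.2 ⟨by omega, le_trans (by gcongr) hY⟩)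
  obtain ⟨c, hc⟩ := hdvd
  have h2 := congr_arg (Nat.cast (R := ℝ)) hc
  push_cast at h2
  have h3 : (x + l)⁻¹ * (Nat.lcmUpto Y : ℝ) = ((d * c : ℕ) : ℝ) := by
    rw [h2, ← hx]
    have : x + (l : ℝ) ≠ 0 := by positivity
    push_cast
    field_simp
  rw [h3]
  exact natCast_mem_intSubring _

theorem exists_lcmUpto_le_pow : ∃ K : ℝ, 1 ≤ K ∧ ∀ Y : ℕ, (Nat.lcmUpto Y : ℝ) ≤ K ^ Y := by
  refine ⟨Real.exp (Real.log 4 + 4), Real.one_le_exp (by positivity), fun Y => ?_⟩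
  have h := Chebyshev.psi_le_const_mul_self (x := (Y : ℝ)) Y.cast_nonneg
  rw [Chebyshev.psi_eq_log_lcmUpto,
    Real.log_le_iff_le_exp (by exact_mod_cast Nat.lcmUpto_pos Y)] at h
  rwa [← Real.exp_nat_mul, mul_comm]

/-! ### The simultaneous approximants -/

/-- The moments `∏ (α i)_k / ∏ (β i)_{k + [i ≤ j]}`. -/
noncomputable def moment {p q : ℕ} (α : Fin p → ℝ) (β : Fin q → ℝ) (j : Fin q) (k : ℕ) : ℝ :=
  (∏ i, risingFac (α i) k) / ∏ i, risingFac (β i) (k + if i ≤ j then 1 else 0)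

/-- The functional sending `X ^ k` to the `k`-th moment. -/
noncomputable def momentFunctional {p q : ℕ} (α : Fin p → ℝ) (β : Fin q → ℝ) (j : Fin q) :
    ℝ[X] →ₗ[ℝ] ℝ :=
  Polynomial.lsum fun k => LinearMap.toSpanSingleton ℝ ℝ (moment α β j k)

theorem momentFunctional_X_pow {p q : ℕ} (α : Fin p → ℝ) (β : Fin q → ℝ) (j : Fin q) (k : ℕ) :
    momentFunctional α β j (X ^ k) = moment α β j k := by
  simp [momentFunctional, Polynomial.lsum_apply, ← monomial_one_right_eq_X_pow, sum_monomial_index]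

/-- The `i`-th component of the `N`-th multi-index on the step line. -/
def stepIdx (q N : ℕ) (i : Fin q) : ℕ := N / q + if (i : ℕ) < N % q then 1 else 0

/-- The coefficients of the common denominator of the `N`-th simultaneous approximant. -/
noncomputable def approxCoeff {p q : ℕ} (α : Fin p → ℝ) (β : Fin q → ℝ) (N l : ℕ) : ℝ :=
  (-1) ^ l * (N.choose l : ℝ) *
    ((∏ i, risingFac (β i) (l + stepIdx q N i)) / ∏ i, risingFac (α i) l)

/-- The common denominator of the `N`-th simultaneous approximant. -/
noncomputable def approxPoly {p q : ℕ} (α : Fin p → ℝ) (β : Fin q → ℝ) (N : ℕ) : ℝ[X] :=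
  ∑ l ∈ Finset.range (N + 1), approxCoeff α β N l • X ^ l

section
variable {p q : ℕ} {α : Fin p → ℝ} {β : Fin q → ℝ}

theorem degree_approxPoly (hα : ∀ i, 0 < α i) (hβ : ∀ i, 0 < β i) (N : ℕ) :
    (approxPoly α β N).degree = N := by
  have hc : approxCoeff α β N N ≠ 0 := by
    have h1 := (Finset.prod_pos fun i (_ : i ∈ Finset.univ) => risingFac_pos (hα i) N).ne'
    have h2 := (Finset.prod_pos fun i (_ : i ∈ Finset.univ) =>
      risingFac_pos (hβ i) (N + stepIdx q N i)).ne'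
    simp [approxCoeff, h1, h2]
  rw [approxPoly, Finset.sum_range_succ, degree_add_eq_right_of_degree_lt]
  · rw [smul_eq_C_mul, degree_C_mul hc, degree_X_pow]
  · rw [smul_eq_C_mul, degree_C_mul hc, degree_X_pow]
    refine lt_of_le_of_lt (degree_sum_le _ _) ((Finset.sup_lt_iff (WithBot.bot_lt_coe _)).2
      fun l hl => ?_)
    refine lt_of_le_of_lt (degree_smul_le _ _) ?_
    rw [degree_X_pow]
    exact_mod_cast Finset.mem_range.1 hl

theorem momentFunctional_approxPoly (j : Fin q) (m N : ℕ) :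
    momentFunctional α β j (X ^ m * approxPoly α β N) =
      ∑ l ∈ Finset.range (N + 1), approxCoeff α β N l * moment α β j (l + m) := by
  rw [approxPoly, Finset.mul_sum, map_sum]
  refine Finset.sum_congr rfl fun l _ => ?_
  rw [mul_smul_comm, map_smul, ← pow_add, momentFunctional_X_pow, smul_eq_mul, add_comm]

theorem sum_stepIdx (hq : 0 < q) (N : ℕ) : ∑ i, stepIdx q N i = N := by
  have h : ∑ i : Fin q, (if (i : ℕ) < N % q then 1 else 0) = N % q := by
    rw [Fin.sum_univ_eq_sum_range (fun i => if i < N % q then 1 else 0) q, Finset.sum_boole]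
    have : (Finset.range q).filter (· < N % q) = Finset.range (N % q) := by
      ext i
      have := Nat.mod_lt N hq
      simp only [Finset.mem_filter, Finset.mem_range]; omega
    simp [this]
  simp only [stepIdx, Finset.sum_add_distrib, h]
  simp [Nat.div_add_mod]

theorem sum_le_indicator (j : Fin q) : ∑ i : Fin q, (if i ≤ j then 1 else 0) = (j : ℕ) + 1 := by
  rw [Finset.sum_boole]
  have : Finset.univ.filter (· ≤ j) = Finset.Iic j := by ext; simp
  simp [this]

/-- Under `h` all denominators cancel, so apart from the signed binomial the product is a polynomial
in l. -/
theorem approxCoeff_mul_moment (hα : ∀ i, 0 < α i) (hβ : ∀ i, 0 < β i) (j : Fin q) (m N l : ℕ)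
    (h : ∀ i, m + (if i ≤ j then 1 else 0) ≤ stepIdx q N i) :
    approxCoeff α β N l * moment α β j (l + m) = (-1) ^ l * (N.choose l : ℝ) *
      ((∏ i, risingFac (α i + l) m) * ∏ i, risingFac (β i + (m + if i ≤ j then 1 else 0 : ℕ) + l)
        (stepIdx q N i - (m + if i ≤ j then 1 else 0))) := by
  have h1 : ∏ i, risingFac (α i) (l + m) =
      (∏ i, risingFac (α i) l) * ∏ i, risingFac (α i + l) m := by
    simp_rw [risingFac_add, Finset.prod_mul_distrib]
  have h2 : ∏ i, risingFac (β i) (l + stepIdx q N i) =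
      (∏ i, risingFac (β i) (l + m + if i ≤ j then 1 else 0)) *
        ∏ i, risingFac (β i + (m + if i ≤ j then 1 else 0 : ℕ) + l)
        (stepIdx q N i - (m + if i ≤ j then 1 else 0)) := by
    rw [← Finset.prod_mul_distrib]
    refine Finset.prod_congr rfl fun i _ => ?_
    have e : l + stepIdx q N i = (l + m + if i ≤ j then 1 else 0) +
      (stepIdx q N i - (m + if i ≤ j then 1 else 0)) := by have := h i; omega
    rw [e, risingFac_add]
    push_cast
    congr 2
    ring_nf
  have h3 := (Finset.prod_pos fun i (_ : i ∈ Finset.univ) => risingFac_pos (hα i) l).ne'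
  have h4 := (Finset.prod_pos fun i (_ : i ∈ Finset.univ) =>
      risingFac_pos (hβ i) (l + m + if i ≤ j then 1 else 0)).ne'
  rw [approxCoeff, moment, h1, h2]
  field_simp

/-- Orthogonality of the approximants. -/
theorem momentFunctional_eq_zero (hq : 0 < q) (hpq : p ≤ q) (hα : ∀ i, 0 < α i)
    (hβ : ∀ i, 0 < β i) (j : Fin q) (m N : ℕ) (h : q * m + j < N) :
    momentFunctional α β j (X ^ m * approxPoly α β N) = 0 := by
  have hle : ∀ i, m + (if i ≤ j then 1 else 0) ≤ stepIdx q N i := by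
    intro i
    have hN := Nat.div_add_mod N q
    have hmn : m ≤ N / q := by
      rw [Nat.le_div_iff_mul_le hq, mul_comm]; omega
    rw [stepIdx]
    rcases Nat.eq_or_lt_of_le hmn with he | hlt
    · have : (j : ℕ) < N % q := by rw [he] at h; omega
      by_cases hij : i ≤ j
      · have : (i : ℕ) < N % q := lt_of_le_of_lt hij this
        simp [hij, this, he]
      · simp [hij, he]
    · split_ifs <;> omega
  obtain ⟨G, hG, hGe⟩ := exists_polynomial_prod_risingFac Finset.univ α fun _ => m
  obtain ⟨H, hH, hHe⟩ := exists_polynomial_prod_risingFac Finset.univ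
    (fun i => β i + (m + if i ≤ j then 1 else 0 : ℕ))
    (fun i => stepIdx q N i - (m + if i ≤ j then 1 else 0))
  -- The degree is at most pm + N − (qm + j + 1), because the components of the multi-index sum to
  -- N.
  have hdeg : (G * H).natDegree < N := by
    have h1 : ∑ i, (stepIdx q N i - (m + if i ≤ j then 1 else 0)) + (q * m + (j + 1)) = N := by
      conv_rhs => rw [← sum_stepIdx hq N]
      rw [← sum_le_indicator j, show q * m = ∑ _i : Fin q, m by simp, ← Finset.sum_add_distrib,
        ← Finset.sum_add_distrib]
      exact Finset.sum_congr rfl fun i _ => Nat.sub_add_cancel (hle i)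
    have h2 : p * m ≤ q * m := Nat.mul_le_mul_right m hpq
    have h3 : ∑ _i : Fin p, m = p * m := by simp
    have := natDegree_mul_le (p := G) (q := H)
    omega
  rw [momentFunctional_approxPoly, ← alternating_sum_polynomial
    (degree_lt_iff_coeff_zero _ _ |>.2 fun k hk =>
      coeff_eq_zero_of_natDegree_lt (lt_of_lt_of_le hdeg hk))]
  refine Finset.sum_congr rfl fun l _ => ?_
  rw [approxCoeff_mul_moment hα hβ j m N l hle, eval_mul, hGe, hHe]

/-- Normality of the step-line multi-indices. -/
theorem momentFunctional_ne_zero (hq : 0 < q) (hpq : p ≤ q) (hα : ∀ i, 0 < α i)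
    (hβ : ∀ i, 0 < β i) (hαβ : ∀ i j (m : ℕ), 0 < m → α i - β j ≠ m) (N : ℕ) :
    momentFunctional α β ⟨N % q, Nat.mod_lt N hq⟩ (X ^ (N / q) * approxPoly α β N) ≠ 0 := by
  set s : Fin q := ⟨N % q, Nat.mod_lt N hq⟩ with hs
  set n := N / q with hn
  obtain ⟨G, hG, hGe⟩ := exists_polynomial_prod_risingFac Finset.univ α fun _ => n
  have hGN : G.natDegree ≤ N := by
    refine hG.trans ?_
    have h1 := Nat.div_add_mod N q
    rw [← hn] at h1
    have h2 : p * n ≤ q * n := Nat.mul_le_mul_right n hpq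
    simp only [Finset.sum_const, Finset.card_univ, Fintype.card_fin, smul_eq_mul]
    omega
  have hx : 0 < β s + n := add_pos_of_pos_of_nonneg (hβ s) n.cast_nonneg
  -- At the critical order all β-factors cancel except a single β_s + n + l left in the denominator,
  -- so the sum is a simple-pole difference.
  have hsum : momentFunctional α β s (X ^ n * approxPoly α β N) =
      G.eval (-(β s + n)) * (N.factorial / risingFac (β s + n) (N + 1)) := by
    rw [momentFunctional_approxPoly, ← alternating_sum_polynomial_div hGN hx]
    refine Finset.sum_congr rfl fun l _ => ?_
    have h1 : ∏ i, risingFac (α i) (l + n) =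
        (∏ i, risingFac (α i) l) * ∏ i, risingFac (α i + l) n := by
      simp_rw [risingFac_add, Finset.prod_mul_distrib]
    have h2 : ∏ i, risingFac (β i) (l + n + if i ≤ s then 1 else 0) =
        (∏ i, risingFac (β i) (l + stepIdx q N i)) * (β s + n + l) := by
      rw [← Finset.mul_prod_erase _ _ (Finset.mem_univ s), ← Finset.mul_prod_erase Finset.univ
        (fun i => risingFac (β i) (l + stepIdx q N i)) (Finset.mem_univ s)]
      have h3 : ∀ i ∈ Finset.univ.erase s, risingFac (β i) (l + n + if i ≤ s then 1 else 0) =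
          risingFac (β i) (l + stepIdx q N i) := by
        intro i hi
        have hne : (i : ℕ) ≠ N % q := fun h => (Finset.ne_of_mem_erase hi) (Fin.ext h)
        have : i ≤ s ↔ (i : ℕ) < N % q := by
          rw [Fin.le_def, hs]; simp only; omega
        simp only [stepIdx, this, add_assoc, ← hn]
      rw [Finset.prod_congr rfl h3]
      simp only [stepIdx, hs, le_refl, if_true, lt_irrefl, if_false, ← hn, risingFac_succ]
      push_cast
      ring_nf
    have h3 := (Finset.prod_pos fun i (_ : i ∈ Finset.univ) => risingFac_pos (hα i) l).ne'
    have h4 := (Finset.prod_pos fun i (_ : i ∈ Finset.univ) =>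
      risingFac_pos (hβ i) (l + stepIdx q N i)).ne'
    have h5 : β s + n + l ≠ 0 := by positivity
    rw [approxCoeff, moment, h1, h2, hGe]
    field_simp
  rw [hsum, hGe]
  refine mul_ne_zero (Finset.prod_ne_zero_iff.2 fun i _ => ?_)
    (div_ne_zero (by exact_mod_cast N.factorial_ne_zero) (risingFac_pos hx _).ne')
  rw [risingFac_eq_prod]
  refine Finset.prod_ne_zero_iff.2 fun r hr h0 => ?_
  have hr' := Finset.mem_range.1 hr
  -- The r-th factor of (α_i − β_s − n)_n vanishes only if α_i − β_s = n − r, a positive integer.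
  refine hαβ i s (n - r) (by omega) ?_
  rw [Nat.cast_sub hr'.le]
  linarith

end

/-! ### Size of the remainders -/

section
variable {p q : ℕ} {α : Fin p → ℝ} {β : Fin q → ℝ}

theorem exists_common_risingFac_bound (hα : ∀ i, 0 < α i) (hβ : ∀ i, 0 < β i) :
    ∃ K : ℝ, 2 ≤ K ∧
      (∀ i k, risingFac (α i) k ≤ K ^ k * k.factorial ∧
        (k.factorial : ℝ) ≤ K ^ k * risingFac (α i) k) ∧
      ∀ i k, risingFac (β i) k ≤ K ^ k * k.factorial ∧
        (k.factorial : ℝ) ≤ K ^ k * risingFac (β i) k := by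
  choose c hc hcK using fun i => exists_risingFac_bound (hα i)
  choose d hd hdK using fun i => exists_risingFac_bound (hβ i)
  have hc0 : ∀ i, 0 ≤ c i := fun i => zero_le_one.trans (hc i)
  have hd0 : ∀ i, 0 ≤ d i := fun i => zero_le_one.trans (hd i)
  have hcs : 0 ≤ ∑ i, c i := Finset.sum_nonneg fun i _ => hc0 i
  have hds : 0 ≤ ∑ i, d i := Finset.sum_nonneg fun i _ => hd0 i
  refine ⟨2 + ∑ i, c i + ∑ i, d i, by linarith, fun i => hcK i _ ?_, fun i => hdK i _ ?_⟩
  · have := Finset.single_le_sum (fun i _ => hc0 i) (Finset.mem_univ i)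
    linarith
  · have := Finset.single_le_sum (fun i _ => hd0 i) (Finset.mem_univ i)
    linarith

theorem stepIdx_bounds (hq : 0 < q) {n N : ℕ} (h1 : q * n ≤ N) (h2 : N ≤ q * (n + 1)) (i : Fin q) :
    n ≤ stepIdx q N i ∧ stepIdx q N i ≤ n + 1 := by
  have hN := Nat.div_add_mod N q
  have hle : n ≤ N / q := by rwa [Nat.le_div_iff_mul_le hq, mul_comm]
  have hle' : N / q ≤ n + 1 := by
    rw [Nat.div_le_iff_le_mul_add_pred hq]; omega
  rw [stepIdx]
  rcases Nat.eq_or_lt_of_le hle' with he | hlt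
  · have : N % q = 0 := by rw [he] at hN; omega
    simp [this, he]
  · split_ifs <;> omega

/-- Pair p factors as (l+n)!/l!, a binomial times n!. Each of the other q − p ≥ 1 factors
(l+n)!/(l+n+t)! is at most 1/t!, and one of these is kept for convergence in t. -/
theorem factorial_quotient_bound (hpq : p < q) (l n t : ℕ) :
    ((l + n).factorial : ℝ) ^ q * ((l + (n + t)).factorial : ℝ) ^ p /
      ((l.factorial : ℝ) ^ p * ((l + (n + t)).factorial : ℝ) ^ q) ≤
      (2 ^ (l + n) * n.factorial) ^ p / t.factorial := by
  obtain ⟨r, rfl⟩ := Nat.exists_eq_add_of_lt hpq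
  have hl : (0 : ℝ) < l.factorial := by exact_mod_cast l.factorial_pos
  have hF : (0 : ℝ) < (l + n).factorial := by exact_mod_cast (l + n).factorial_pos
  have hM : (0 : ℝ) < (l + (n + t)).factorial := by exact_mod_cast (l + (n + t)).factorial_pos
  have ht : (1 : ℝ) ≤ t.factorial := by exact_mod_cast t.factorial_pos
  have h1 : ((l + n).factorial : ℝ) / l.factorial ≤ 2 ^ (l + n) * n.factorial := by
    rw [div_le_iff₀ hl]
    have e1 := Nat.add_choose_mul_factorial_mul_factorial l n
    have e2 : (l + n).choose n ≤ 2 ^ (l + n) := Nat.choose_le_two_pow _ _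
    rw [← e1]
    push_cast
    have e3 : ((l + n).choose n : ℝ) ≤ 2 ^ (l + n) := by exact_mod_cast e2
    have : (0 : ℝ) ≤ l.factorial * n.factorial := by positivity
    nlinarith
  have h2 : ((l + n).factorial : ℝ) / (l + (n + t)).factorial ≤ 1 / t.factorial := by
    rw [div_le_div_iff₀ hM (by positivity), one_mul, ← add_assoc]
    exact_mod_cast Nat.le_of_dvd (Nat.factorial_pos _) (Nat.factorial_mul_factorial_dvd_factorial_add _ _)
  have e : ((l + n).factorial : ℝ) ^ (p + r + 1) * ((l + (n + t)).factorial : ℝ) ^ p /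
      ((l.factorial : ℝ) ^ p * ((l + (n + t)).factorial : ℝ) ^ (p + r + 1)) =
      (((l + n).factorial : ℝ) / l.factorial) ^ p *
        (((l + n).factorial : ℝ) / (l + (n + t)).factorial) ^ (r + 1) := by
    rw [div_pow, div_pow, add_assoc p r 1, pow_add _ p (r + 1), pow_add _ p (r + 1)]
    field_simp
  rw [e, div_eq_mul_one_div _ (t.factorial : ℝ)]
  gcongr
  calc (((l + n).factorial : ℝ) / (l + (n + t)).factorial) ^ (r + 1)
      ≤ (1 / (t.factorial : ℝ)) ^ (r + 1) := by gcongr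
    _ ≤ (1 / (t.factorial : ℝ)) ^ 1 := by
        apply pow_le_pow_of_le_one (by positivity) _ (by omega)
        rw [div_le_one (by positivity)]; exact ht
    _ = _ := pow_one _

theorem exists_approxCoeff_mul_moment_bound (hpq : p < q) (hα : ∀ i, 0 < α i) (hβ : ∀ i, 0 < β i) :
    ∃ E : ℝ, 2 ≤ E ∧ ∀ (j : Fin q) (n N l t : ℕ), q * n ≤ N → N ≤ q * (n + 1) → l ≤ N →
      |approxCoeff α β N l * moment α β j (l + (n + t))| ≤
        E ^ ((q + 1) * (n + 1) + t) * (n.factorial : ℝ) ^ p / t.factorial := by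
  obtain ⟨K, hK, hKα, hKβ⟩ := exists_common_risingFac_bound hα hβ
  have hK1 : 1 ≤ K := by linarith
  have hK0 : 0 < K := by linarith
  -- Count of factors K^S: 1 for the binomial, 2q and q for the β numerators and denominators, p and
  -- p for the α ones, and p from 2^(l+n) in `factorial_quotient_bound`. The exponent S exceeds
  -- every index that occurs.
  refine ⟨K ^ (1 + 3 * p + 3 * q), hK.trans (le_self_pow₀ hK1 (by omega)), ?_⟩
  intro j n N l t hN1 hN2 hl
  set S := (q + 1) * (n + 1) + t with hS
  have hqn : q * (n + 1) + (n + 1) + t = S := by rw [hS]; ring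
  have hpowS : ∀ k ≤ S, K ^ k ≤ K ^ S := fun k hk => pow_le_pow_right₀ hK1 hk
  have h2S : ∀ k ≤ S, (2 : ℝ) ^ k ≤ K ^ S := fun k hk =>
    (pow_le_pow_left₀ (by norm_num) hK k).trans (hpowS k hk)
  have hfac : ∀ k : ℕ, (0 : ℝ) < k.factorial := fun k => by exact_mod_cast k.factorial_pos
  have hchoose : (N.choose l : ℝ) ≤ K ^ S := by
    refine le_trans ?_ (h2S N (by omega))
    exact_mod_cast Nat.choose_le_two_pow N l
  have hβnum : ∏ i, risingFac (β i) (l + stepIdx q N i) ≤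
      (K ^ S * K ^ S * (l + n).factorial) ^ q := by
    have : ∀ i ∈ Finset.univ, risingFac (β i) (l + stepIdx q N i) ≤
        K ^ S * K ^ S * (l + n).factorial := by
      intro i _
      obtain ⟨_, h⟩ := stepIdx_bounds (by omega) hN1 hN2 i
      refine (hKβ i _).1.trans ?_
      have h1 : ((l + stepIdx q N i).factorial : ℝ) ≤ K ^ S * (l + n).factorial := by
        calc ((l + stepIdx q N i).factorial : ℝ) ≤ (l + n + 1).factorial := by
              exact_mod_cast Nat.factorial_le (by omega)
          _ = ((l + n + 1 : ℕ) : ℝ) * (l + n).factorial := by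
              rw [Nat.factorial_succ]; push_cast; ring
          _ ≤ K ^ S * (l + n).factorial := by
              gcongr
              refine le_trans ?_ (h2S (l + n + 1) (by omega))
              exact_mod_cast Nat.lt_two_pow_self.le
      rw [mul_assoc]
      exact mul_le_mul (hpowS _ (by omega)) h1 (hfac _).le (by positivity)
    simpa using Finset.prod_le_prod (fun i _ => (risingFac_pos (hβ i) _).le) this
  have hαnum : ∏ i, risingFac (α i) (l + (n + t)) ≤ (K ^ S * (l + (n + t)).factorial) ^ p := by
    have : ∀ i ∈ Finset.univ, risingFac (α i) (l + (n + t)) ≤ K ^ S * (l + (n + t)).factorial :=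
      fun i _ => (hKα i _).1.trans
        (mul_le_mul_of_nonneg_right (hpowS _ (by omega)) (hfac _).le)
    simpa using Finset.prod_le_prod (fun i _ => (risingFac_pos (hα i) _).le) this
  have hαden : (∏ i, risingFac (α i) l)⁻¹ ≤ (K ^ S / l.factorial) ^ p := by
    have : ∀ i ∈ Finset.univ, (risingFac (α i) l)⁻¹ ≤ K ^ S / l.factorial := by
      intro i _
      have hp := risingFac_pos (hα i) l
      rw [inv_eq_one_div, div_le_div_iff₀ hp (hfac l), one_mul]
      exact (hKα i l).2.trans (mul_le_mul_of_nonneg_right (hpowS _ (by omega)) hp.le)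
    rw [← Finset.prod_inv_distrib]
    refine (Finset.prod_le_prod (fun i _ => (inv_pos.2 (risingFac_pos (hα i) _)).le) this).trans ?_
    rw [Finset.prod_const, Finset.card_univ, Fintype.card_fin]
  have hβden : (∏ i, risingFac (β i) (l + (n + t) + if i ≤ j then 1 else 0))⁻¹ ≤
      (K ^ S / (l + (n + t)).factorial) ^ q := by
    have : ∀ i ∈ Finset.univ, (risingFac (β i) (l + (n + t) + if i ≤ j then 1 else 0))⁻¹ ≤
        K ^ S / (l + (n + t)).factorial := by
      intro i _
      have hp := risingFac_pos (hβ i) (l + (n + t) + if i ≤ j then 1 else 0)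
      rw [inv_eq_one_div, div_le_div_iff₀ hp (hfac _), one_mul]
      calc ((l + (n + t)).factorial : ℝ) ≤ (l + (n + t) + if i ≤ j then 1 else 0).factorial := by
            exact_mod_cast Nat.factorial_le (by omega)
        _ ≤ _ := (hKβ i _).2
        _ ≤ _ := mul_le_mul_of_nonneg_right (hpowS _ (by split_ifs <;> omega)) hp.le
    rw [← Finset.prod_inv_distrib]
    refine (Finset.prod_le_prod (fun i _ => (inv_pos.2 (risingFac_pos (hβ i) _)).le) this).trans ?_
    rw [Finset.prod_const, Finset.card_univ, Fintype.card_fin]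
  have hp1 : 0 < ∏ i, risingFac (β i) (l + stepIdx q N i) :=
    Finset.prod_pos fun i _ => risingFac_pos (hβ i) _
  have hp2 : 0 < ∏ i, risingFac (α i) (l + (n + t)) :=
    Finset.prod_pos fun i _ => risingFac_pos (hα i) _
  have hp3 : 0 < ∏ i, risingFac (α i) l := Finset.prod_pos fun i _ => risingFac_pos (hα i) _
  have hp4 : 0 < ∏ i, risingFac (β i) (l + (n + t) + if i ≤ j then 1 else 0) :=
    Finset.prod_pos fun i _ => risingFac_pos (hβ i) _
  have habs : |approxCoeff α β N l * moment α β j (l + (n + t))| =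
      (N.choose l : ℝ) * (∏ i, risingFac (β i) (l + stepIdx q N i)) *
      (∏ i, risingFac (α i) (l + (n + t))) * (∏ i, risingFac (α i) l)⁻¹ *
      (∏ i, risingFac (β i) (l + (n + t) + if i ≤ j then 1 else 0))⁻¹ := by
    rw [approxCoeff, moment]
    simp only [abs_mul, abs_div, abs_pow, abs_neg, abs_one, one_pow, one_mul, Nat.abs_cast,
      abs_of_pos hp1, abs_of_pos hp2, abs_of_pos hp3, abs_of_pos hp4]
    ring
  have hquot := factorial_quotient_bound hpq l n t
  rw [habs]
  calc _ ≤ K ^ S * (K ^ S * K ^ S * (l + n).factorial) ^ q *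
        (K ^ S * (l + (n + t)).factorial) ^ p * (K ^ S / l.factorial) ^ p *
        (K ^ S / (l + (n + t)).factorial) ^ q := by
        gcongr
    _ = (K ^ S) ^ (1 + 2 * p + 3 * q) * (((l + n).factorial : ℝ) ^ q *
        ((l + (n + t)).factorial : ℝ) ^ p /
      ((l.factorial : ℝ) ^ p * ((l + (n + t)).factorial : ℝ) ^ q)) := by
        simp only [mul_pow, div_pow, pow_add, pow_mul]
        field_simp
        ring
    _ ≤ (K ^ S) ^ (1 + 2 * p + 3 * q) * ((K ^ S * n.factorial) ^ p / t.factorial) := by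
        refine mul_le_mul_of_nonneg_left (hquot.trans ?_) (by positivity)
        gcongr
        exact h2S _ (by omega)
    _ = _ := by
        rw [mul_pow, ← pow_mul K (1 + 3 * p + 3 * q), mul_comm _ S, pow_mul K S]
        ring

theorem exists_momentFunctional_bound (hpq : p < q) (hα : ∀ i, 0 < α i) (hβ : ∀ i, 0 < β i) :
    ∃ E : ℝ, 0 < E ∧ ∀ (j : Fin q) (n N t : ℕ), q * n ≤ N → N ≤ q * (n + 1) →
      |∑ l ∈ Finset.range (N + 1), approxCoeff α β N l * moment α β j (l + (n + t))| ≤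
        E ^ ((q + 1) * (n + 1) + t) * (n.factorial : ℝ) ^ p / t.factorial := by
  obtain ⟨E, hE, hbd⟩ := exists_approxCoeff_mul_moment_bound hpq hα hβ
  refine ⟨2 * E, by linarith, fun j n N t h1 h2 => ?_⟩
  refine (Finset.abs_sum_le_sum_abs _ _).trans ?_
  refine (Finset.sum_le_sum fun l hl => hbd j n N l t h1 h2
    (Nat.lt_succ_iff.1 (Finset.mem_range.1 hl))).trans ?_
  rw [Finset.sum_const, Finset.card_range, nsmul_eq_mul, mul_pow, mul_assoc (2 ^ _), mul_div_assoc ((2 : ℝ) ^ _)]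
  have : ((N + 1 : ℕ) : ℝ) ≤ 2 ^ ((q + 1) * (n + 1) + t) := by
    have h3 : N + 1 ≤ (q + 1) * (n + 1) + t := by nlinarith
    calc ((N + 1 : ℕ) : ℝ) ≤ 2 ^ (N + 1) := by exact_mod_cast Nat.lt_two_pow_self.le
      _ ≤ _ := pow_le_pow_right₀ (by norm_num) h3
  exact mul_le_mul_of_nonneg_right this (by positivity)

theorem summable_moment (hpq : p < q) (hα : ∀ i, 0 < α i) (hβ : ∀ i, 0 < β i) (j : Fin q) (z : ℝ) :
    Summable fun k => moment α β j k * z ^ k := by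
  obtain ⟨E, hE, hbd⟩ := exists_approxCoeff_mul_moment_bound hpq hα hβ
  refine Summable.of_norm_bounded (g := fun k : ℕ => E ^ (q + 1) * ((E * |z|) ^ k / k.factorial))
    ((Real.summable_pow_div_factorial _).mul_left _) fun k => ?_
  -- For n = N = l = 0 the coefficient is 1, so the bound is one on the moments themselves.
  have h := hbd j 0 0 0 k (by simp) (by simp) le_rfl
  have h0 : approxCoeff α β 0 0 = 1 := by simp [approxCoeff, stepIdx]
  rw [h0, one_mul] at h
  simp only [zero_add, mul_one, Nat.factorial_zero, Nat.cast_one, one_pow] at h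
  rw [Real.norm_eq_abs, abs_mul, abs_pow]
  calc |moment α β j k| * |z| ^ k ≤ E ^ (q + 1 + k) / k.factorial * |z| ^ k := by gcongr
    _ = _ := by rw [pow_add, mul_pow]; ring

/-- The divided difference of X^l at 1/z contributes exactly the first l terms of the rescaled
series, leaving its tail. -/
theorem hasSum_monomial_remainder {z : ℝ} (hz : z ≠ 0) (j : Fin q)
    (hs : Summable fun k => moment α β j k * z ^ k) (l : ℕ) :
    HasSum (fun m => moment α β j (l + m) * z ^ (m + 1))
      (z⁻¹ ^ l * (z * ∑' k, moment α β j k * z ^ k) -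
        momentFunctional α β j (dividedDiff z⁻¹ (X ^ l))) := by
  have h1 := (hasSum_nat_add_iff' l).2 hs.hasSum
  have h2 := h1.mul_left (z⁻¹ ^ l * z)
  have e1 : (fun m => moment α β j (l + m) * z ^ (m + 1)) =
      fun m => z⁻¹ ^ l * z * (moment α β j (m + l) * z ^ (m + l)) := by
    ext m
    rw [add_comm l m, pow_add, pow_add, inv_pow]
    field_simp
  rw [e1]
  suffices e2 : z⁻¹ ^ l * (z * ∑' k, moment α β j k * z ^ k) -
      momentFunctional α β j (dividedDiff z⁻¹ (X ^ l)) = z⁻¹ ^ l * z *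
      (∑' k, moment α β j k * z ^ k - ∑ k ∈ Finset.range l, moment α β j k * z ^ k) by
    rw [e2]; exact h2
  · rw [mul_sub, mul_assoc, dividedDiff_X_pow, map_sum, Finset.mul_sum]
    congr 1
    refine Finset.sum_congr rfl fun k hk => ?_
    have hk' := Finset.mem_range.1 hk
    rw [mul_comm, ← C_pow, ← smul_eq_C_mul, map_smul, momentFunctional_X_pow, smul_eq_mul]
    obtain ⟨r, rfl⟩ := Nat.exists_eq_add_of_lt hk'
    rw [show k + r + 1 - 1 - k = r by omega]
    simp only [inv_pow, pow_add]
    field_simp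

/-- The remainder of the `N`-th approximant. -/
noncomputable def remainder (α : Fin p → ℝ) (β : Fin q → ℝ) (z : ℝ) (j : Fin q) (N : ℕ) : ℝ :=
  (approxPoly α β N).eval z⁻¹ * (z * ∑' k, moment α β j k * z ^ k) -
        momentFunctional α β j (dividedDiff z⁻¹ (approxPoly α β N))

theorem hasSum_remainder {z : ℝ} (hz : z ≠ 0) (j : Fin q)
    (hs : Summable fun k => moment α β j k * z ^ k) (N : ℕ) :
    HasSum (fun m => (∑ l ∈ Finset.range (N + 1),
      approxCoeff α β N l * moment α β j (l + m)) * z ^ (m + 1)) (remainder α β z j N) := by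
  have h := hasSum_sum (s := Finset.range (N + 1)) fun l _ =>
    (hasSum_monomial_remainder hz j hs l).mul_left (approxCoeff α β N l)
  have e1 : (fun m => (∑ l ∈ Finset.range (N + 1),
      approxCoeff α β N l * moment α β j (l + m)) * z ^ (m + 1)) = fun m =>
      ∑ l ∈ Finset.range (N + 1), approxCoeff α β N l * (moment α β j (l + m) * z ^ (m + 1)) := by
    ext m
    rw [Finset.sum_mul]
    exact Finset.sum_congr rfl fun l _ => by ring
  rw [e1]
  suffices e2 : remainder α β z j N = ∑ l ∈ Finset.range (N + 1), approxCoeff α β N l *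
      (z⁻¹ ^ l * (z * ∑' k, moment α β j k * z ^ k) -
        momentFunctional α β j (dividedDiff z⁻¹ (X ^ l))) by
    rw [e2]; exact h
  · rw [remainder, approxPoly, map_sum, map_sum, eval_finsetSum, Finset.sum_mul,
      ← Finset.sum_sub_distrib]
    refine Finset.sum_congr rfl fun l _ => ?_
    simp only [map_smul, smul_eq_mul, eval_smul, eval_pow, eval_X]
    ring

theorem exists_remainder_bound (hpq : p < q) (hα : ∀ i, 0 < α i) (hβ : ∀ i, 0 < β i) {z : ℝ}
    (hz : z ≠ 0) : ∃ K : ℝ, 0 < K ∧ ∀ (j : Fin q) (n N : ℕ), q * n ≤ N → N ≤ q * (n + 1) →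
      |remainder α β z j N| ≤ K ^ (n + 1) * (n.factorial : ℝ) ^ p := by
  obtain ⟨E, hE, hbd⟩ := exists_momentFunctional_bound hpq hα hβ
  have hexp : 1 ≤ Real.exp (E * |z|) := Real.one_le_exp (by positivity)
  refine ⟨E ^ (q + 1) * |z| * Real.exp (E * |z|), by positivity, fun j n N h1 h2 => ?_⟩
  have hsum := hasSum_remainder hz j (summable_moment hpq hα hβ j z) N
  have hzero : ∀ m < n, ∑ l ∈ Finset.range (N + 1),
      approxCoeff α β N l * moment α β j (l + m) = 0 := by
    intro m hm
    rw [← momentFunctional_approxPoly]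
    exact momentFunctional_eq_zero (by omega) hpq.le hα hβ j m N (by nlinarith [j.2])
  -- Orthogonality removes the first n terms; the rest is dominated by an exponential series.
  have hsum' := (hasSum_nat_add_iff' n).2 hsum
  rw [Finset.sum_eq_zero (fun m hm => by rw [hzero m (Finset.mem_range.1 hm), zero_mul]),
    sub_zero] at hsum'
  have hg : HasSum (fun t : ℕ => (E ^ (q + 1) * |z|) ^ (n + 1) * (n.factorial : ℝ) ^ p *
      ((E * |z|) ^ t / t.factorial))
      ((E ^ (q + 1) * |z|) ^ (n + 1) * (n.factorial : ℝ) ^ p * Real.exp (E * |z|)) := by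
    rw [Real.exp_eq_exp_ℝ]
    exact (NormedSpace.expSeries_div_hasSum_exp (E * |z|)).mul_left _
  have hle := hsum'.norm_le_of_bounded hg fun t => by
    rw [Real.norm_eq_abs, abs_mul, abs_pow, add_comm t n]
    calc _ ≤ E ^ ((q + 1) * (n + 1) + t) * (n.factorial : ℝ) ^ p / t.factorial *
          |z| ^ (n + t + 1) := by
          gcongr
          exact hbd j n N t h1 h2
      _ = _ := by
          rw [mul_pow, mul_pow, pow_add, pow_mul, show n + t + 1 = n + 1 + t by ring,
            pow_add |z| (n + 1)]
          ring
  rw [Real.norm_eq_abs] at hle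
  refine hle.trans ?_
  rw [mul_pow _ (Real.exp _), mul_right_comm]
  gcongr
  exact le_self_pow₀ hexp (by omega)

end

/-! ### Denominators of the approximants -/

theorem exists_common_denominator {ι : Type*} [Fintype ι] (r : ι → ℚ) :
    ∃ d : ℕ, 0 < d ∧ ∀ i, ∃ x : ℤ, (d : ℝ) * r i = x := by
  classical
  refine ⟨∏ i, (r i).den, Finset.prod_pos fun i _ => (r i).den_pos, fun i => ?_⟩
  refine ⟨(∏ k ∈ Finset.univ.erase i, ((r k).den : ℤ)) * (r i).num, ?_⟩
  rw [← Finset.mul_prod_erase _ _ (Finset.mem_univ i)]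
  have h : ((r i).den : ℝ) * r i = (r i).num := by exact_mod_cast Rat.den_mul_eq_num (r i)
  push_cast
  linear_combination (∏ k ∈ Finset.univ.erase i, ((r k).den : ℝ)) * h

theorem exists_common_denominator_of_pos {ι : Type*} [Fintype ι] (r : ι → ℚ) (hr : ∀ i, 0 < r i) :
    ∃ d : ℕ, 0 < d ∧ ∀ i, ∃ x : ℕ, 0 < x ∧ (d : ℝ) * r i = x := by
  obtain ⟨d, hd, h⟩ := exists_common_denominator r
  refine ⟨d, hd, fun i => ?_⟩
  obtain ⟨x, hx⟩ := h i
  have hpos : (0 : ℝ) < x := by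
    rw [← hx]
    exact mul_pos (by exact_mod_cast hd) (by exact_mod_cast hr i)
  have hx0 : 0 < x := by exact_mod_cast hpos
  lift x to ℕ using hx0.le
  exact ⟨x, by exact_mod_cast hx0, by simpa using hx⟩

theorem factorial_mul_lcmUpto_div_risingFac_mem' {x : ℝ} {d x₀ Y : ℕ} (hd : 0 < d) (hx₀ : 0 < x₀)
    (hx : d * x = x₀) (k M : ℕ) (hY : x₀ + d * (k + M) ≤ Y) :
    ((M - 1).factorial : ℝ) * Nat.lcmUpto Y / risingFac (x + k) M ∈ intSubring := by
  cases M with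
  | zero => simp
  | succ M =>
    refine factorial_mul_lcmUpto_div_risingFac_mem (x₀ := x₀ + d * k) hd (by omega)
      (by push_cast; rw [← hx]; ring) M (le_trans ?_ hY)
    nlinarith

/-- Since n! M! divides M'!, a β-factor supplies an extra n! beyond the M! needed to clear an
α-factor. -/
theorem pow_mul_risingFac_div_mem {y : ℝ} {d y₀ : ℕ} (hy : d * y = y₀) {ε n M M' H : ℕ}
    (hM : M + n ≤ M') (hH : M' ≤ H) :
    (d : ℝ) ^ (2 * H) * risingFac (y + ε) M' / (n.factorial * M.factorial) ∈ intSubring := by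
  have h1 := pow_mul_risingFac_div_factorial_mem (x := y + ε) (d := d) (x₀ := y₀ + d * ε)
    (by push_cast; rw [← hy]; ring) M'
  obtain ⟨c, hc⟩ : n.factorial * M.factorial ∣ M'.factorial :=
    (Nat.factorial_mul_factorial_dvd_factorial_add n M).trans (Nat.factorial_dvd_factorial (by omega))
  have h2 := congr_arg (Nat.cast (R := ℝ)) hc
  push_cast at h2
  have hn : (n.factorial : ℝ) ≠ 0 := by exact_mod_cast n.factorial_ne_zero
  have hm : (M.factorial : ℝ) ≠ 0 := by exact_mod_cast M.factorial_ne_zero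
  have hm' : (M'.factorial : ℝ) ≠ 0 := by exact_mod_cast M'.factorial_ne_zero
  have h3 : (d : ℝ) ^ (2 * H) * risingFac (y + ε) M' / (n.factorial * M.factorial) =
      (d : ℝ) ^ (2 * (H - M')) * ((d : ℝ) ^ (2 * M') * risingFac (y + ε) M' / M'.factorial) * c := by
    obtain ⟨r, rfl⟩ := Nat.exists_eq_add_of_le hH
    rw [Nat.add_sub_cancel_left, mul_add, pow_add, div_eq_iff (mul_ne_zero hn hm)]
    field_simp
    rw [h2]
    ring
  rw [h3]
  exact mul_mem (mul_mem (pow_mem (natCast_mem_intSubring d) _) h1) (natCast_mem_intSubring c)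

section
variable {p q : ℕ} {α : Fin p → ℝ} {β : Fin q → ℝ}

/-- The q numerators supply (n! (M−1)!)^q and the p denominators consume (M−1)!^p. The spare n!^q is
what makes the multiplier D_n factorially small. -/
theorem prod_risingFac_quotient_mem (hpq : p ≤ q) {d e Y n k M H : ℕ} {x : Fin p → ℕ} {y : Fin q → ℕ}
    (hd : 0 < d) (hx₀ : ∀ i, 0 < x i) (hx : ∀ i, d * α i = x i) (hy : ∀ i, e * β i = y i)
    (hY : ∀ i, x i + d * (k + M) ≤ Y) (ε M' : Fin q → ℕ) (hM : ∀ i, M - 1 + n ≤ M' i)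
    (hH : ∀ i, M' i ≤ H) :
    ((e : ℝ) ^ (2 * H)) ^ q * (Nat.lcmUpto Y : ℝ) ^ p / (n.factorial : ℝ) ^ q *
      ((∏ i, risingFac (β i + ε i) (M' i)) / ∏ i, risingFac (α i + k) M) ∈ intSubring := by
  have h1 : ∏ i, ((e : ℝ) ^ (2 * H) * risingFac (β i + ε i) (M' i) /
      (n.factorial * (M - 1).factorial)) ∈ intSubring :=
    prod_mem fun i _ => pow_mul_risingFac_div_mem (hy i) (hM i) (hH i)
  have h2 : ∏ i, (((M - 1).factorial : ℝ) * Nat.lcmUpto Y / risingFac (α i + k) M) ∈ intSubring :=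
    prod_mem fun i _ => factorial_mul_lcmUpto_div_risingFac_mem' hd (hx₀ i) (hx i) k M (hY i)
  have h3 : (((M - 1).factorial : ℕ) : ℝ) ^ (q - p) ∈ intSubring :=
    pow_mem (natCast_mem_intSubring _) _
  have hm : ((M - 1).factorial : ℝ) ≠ 0 := by exact_mod_cast (M - 1).factorial_ne_zero
  have hn : (n.factorial : ℝ) ≠ 0 := by exact_mod_cast n.factorial_ne_zero
  have key := mul_mem (mul_mem h1 h2) h3
  simp only [Finset.prod_div_distrib, Finset.prod_mul_distrib, Finset.prod_const, Finset.card_univ,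
    Fintype.card_fin] at key
  convert key using 1
  obtain ⟨r, rfl⟩ := Nat.exists_eq_add_of_le hpq
  rw [Nat.add_sub_cancel_left, pow_add ((M - 1).factorial : ℝ)]
  field_simp

theorem approxCoeff_mul_moment_eq_quotient (hα : ∀ i, 0 < α i) (hβ : ∀ i, 0 < β i) (j : Fin q)
    {k l N : ℕ} (hk : k < l) :
    approxCoeff α β N l * moment α β j k = (-1) ^ l * (N.choose l : ℝ) *
      ((∏ i, risingFac (β i + (k + if i ≤ j then 1 else 0 : ℕ))
        (l + stepIdx q N i - (k + if i ≤ j then 1 else 0))) /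
          ∏ i, risingFac (α i + k) (l - k)) := by
  have h1 : ∏ i, risingFac (α i) l =
      (∏ i, risingFac (α i) k) * ∏ i, risingFac (α i + k) (l - k) := by
    rw [← Finset.prod_mul_distrib]
    exact Finset.prod_congr rfl fun i _ => by rw [← risingFac_add]; congr 1; omega
  have h2 : ∏ i, risingFac (β i) (l + stepIdx q N i) =
      (∏ i, risingFac (β i) (k + if i ≤ j then 1 else 0)) *
        ∏ i, risingFac (β i + (k + if i ≤ j then 1 else 0 : ℕ))
          (l + stepIdx q N i - (k + if i ≤ j then 1 else 0)) := by
    rw [← Finset.prod_mul_distrib]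
    exact Finset.prod_congr rfl fun i _ => by
      rw [← risingFac_add]; congr 1; split_ifs <;> omega
  have h3 := (Finset.prod_pos fun i (_ : i ∈ Finset.univ) => risingFac_pos (hα i) k).ne'
  have h4 := (Finset.prod_pos fun i (_ : i ∈ Finset.univ) =>
      risingFac_pos (hβ i) (k + if i ≤ j then 1 else 0)).ne'
  rw [approxCoeff, moment, h1, h2]
  field_simp

theorem exists_denominator (hpq : p < q) (hα : ∀ i, 0 < α i) (hβ : ∀ i, 0 < β i)
    (hdα : ∃ d : ℕ, 0 < d ∧ ∀ i, ∃ x : ℕ, 0 < x ∧ (d : ℝ) * α i = x)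
    (hdβ : ∃ d : ℕ, 0 < d ∧ ∀ i, ∃ x : ℕ, 0 < x ∧ (d : ℝ) * β i = x)
    {w : ℝ} (hw : ∃ g : ℕ, 0 < g ∧ (g : ℝ) * w ∈ intSubring) :
    ∃ (K : ℝ) (D : ℕ → ℝ), 0 < K ∧
      (∀ n, 0 < D n ∧ D n ≤ K ^ (n + 1) / (n.factorial : ℝ) ^ q) ∧
      ∀ n N, q * n ≤ N → N ≤ q * (n + 1) →
        D n * (approxPoly α β N).eval w ∈ intSubring ∧
        ∀ j, D n * momentFunctional α β j (dividedDiff w (approxPoly α β N)) ∈ intSubring := by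
  obtain ⟨d, hd, hdx⟩ := hdα
  choose x hx₀ hx using hdx
  obtain ⟨e, he, hey⟩ := hdβ
  choose y hy₀ hy using hey
  obtain ⟨g, hg, hgw⟩ := hw
  obtain ⟨A, hA, hlcm⟩ := exists_lcmUpto_le_pow
  -- `H n` bounds all lengths of rising factorials and all powers of w; `Y n` bounds the integers
  -- whose lcm is taken.
  let H : ℕ → ℕ := fun n => (q + 1) * (n + 1)
  let Y : ℕ → ℕ := fun n => ∑ i, x i + d * H n
  have hg' : (1 : ℝ) ≤ g := by exact_mod_cast hg
  have he' : (1 : ℝ) ≤ e := by exact_mod_cast he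
  refine ⟨(g : ℝ) ^ (q + 1) * ((e : ℝ) ^ (2 * (q + 1))) ^ q * (A ^ (∑ i, x i + d * (q + 1))) ^ p,
    fun n => (g : ℝ) ^ H n * (((e : ℝ) ^ (2 * H n)) ^ q * (Nat.lcmUpto (Y n) : ℝ) ^ p /
      (n.factorial : ℝ) ^ q), by positivity, fun n => ⟨?_, ?_⟩, fun n N h1 h2 => ?_⟩
  · have : (0 : ℝ) < Nat.lcmUpto (Y n) := by exact_mod_cast Nat.lcmUpto_pos _
    have : (0 : ℝ) < n.factorial := by exact_mod_cast n.factorial_pos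
    positivity
  · beta_reduce
    rw [← mul_div_assoc]
    have hY : Y n ≤ (∑ i, x i + d * (q + 1)) * (n + 1) := by
      simp only [Y, H]
      nlinarith [Nat.zero_le ((∑ i, x i) * n)]
    have h3 : (Nat.lcmUpto (Y n) : ℝ) ≤ (A ^ (∑ i, x i + d * (q + 1))) ^ (n + 1) := by
      rw [← pow_mul]
      exact (hlcm _).trans (pow_le_pow_right₀ hA hY)
    have e1 : (g : ℝ) ^ H n = ((g : ℝ) ^ (q + 1)) ^ (n + 1) := by rw [← pow_mul]
    have e2 : ((e : ℝ) ^ (2 * H n)) ^ q = (((e : ℝ) ^ (2 * (q + 1))) ^ q) ^ (n + 1) := by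
      simp only [← pow_mul, H]; congr 1; ring
    rw [e1, e2, mul_pow, mul_pow, mul_assoc, pow_right_comm _ p (n + 1)]
    gcongr
  · have hNH : q * (n + 1) + (n + 1) = H n := by simp only [H]; ring
    have hxY : ∀ i, ∀ m ≤ H n, x i + d * m ≤ Y n := fun i m hm =>
      Nat.add_le_add (Finset.single_le_sum (fun i _ => Nat.zero_le (x i)) (Finset.mem_univ i))
        (Nat.mul_le_mul_left d hm)
    have hgpow : ∀ m ≤ H n, (g : ℝ) ^ H n * w ^ m ∈ intSubring := by
      intro m hm
      obtain ⟨r, hr⟩ := Nat.exists_eq_add_of_le hm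
      rw [hr, pow_add, mul_right_comm, ← mul_pow]
      exact mul_mem (pow_mem hgw m) (pow_mem (natCast_mem_intSubring g) r)
    have hsign : ∀ l, (-1 : ℝ) ^ l * (N.choose l : ℝ) ∈ intSubring := fun l =>
      mul_mem (pow_mem (neg_mem (one_mem _)) _) (natCast_mem_intSubring _)
    have hstep := stepIdx_bounds (q := q) (by omega) h1 h2
    constructor
    · rw [approxPoly, eval_finsetSum, Finset.mul_sum]
      refine sum_mem fun l hl => ?_
      have hl' : l ≤ N := Nat.lt_succ_iff.1 (Finset.mem_range.1 hl)
      have key := prod_risingFac_quotient_mem hpq.le (Y := Y n) (n := n) (k := 0) (M := l) (H := H n)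
        hd hx₀ hx hy (fun i => hxY i _ (by omega)) (fun _ => 0) (fun i => l + stepIdx q N i)
        (fun i => by have := hstep i; omega) (fun i => by have := hstep i; omega)
      simp only [Nat.cast_zero, add_zero] at key
      have := mul_mem (mul_mem (hgpow l (by omega)) (hsign l)) key
      convert this using 1
      simp only [approxCoeff, eval_smul, eval_pow, eval_X, smul_eq_mul]
      ring
    · intro j
      rw [approxPoly, map_sum, map_sum, Finset.mul_sum]
      refine sum_mem fun l hl => ?_
      have hl' : l ≤ N := Nat.lt_succ_iff.1 (Finset.mem_range.1 hl)
      rw [map_smul, dividedDiff_X_pow, map_smul, map_sum, smul_eq_mul, Finset.mul_sum,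
        Finset.mul_sum]
      refine sum_mem fun k hk => ?_
      have hk' := Finset.mem_range.1 hk
      -- The indicator of i ≤ j may shorten a β-factor by one; the requirement M − 1 + n, rather
      -- than M + n, absorbs this.
      have key := prod_risingFac_quotient_mem hpq.le (Y := Y n) (n := n) (k := k) (M := l - k)
        (H := H n) hd hx₀ hx hy (fun i => hxY i _ (by omega))
        (fun i => k + if i ≤ j then 1 else 0)
        (fun i => l + stepIdx q N i - (k + if i ≤ j then 1 else 0))
        (fun i => by have := hstep i; split_ifs <;> omega) (fun i => by have := hstep i; omega)
      have := mul_mem (mul_mem (hgpow (l - 1 - k) (by omega)) (hsign l)) key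
      convert this using 1
      rw [mul_comm (X ^ k), ← C_pow, ← smul_eq_C_mul, map_smul, momentFunctional_X_pow, smul_eq_mul,
        mul_left_comm (approxCoeff α β N l), approxCoeff_mul_moment_eq_quotient hα hβ j hk']
      ring

end

/-! ### Small integers vanish: triviality of integral relations -/

theorem eq_zero_of_mem_intSubring {x : ℝ} (hx : x ∈ intSubring) (h : |x| < 1) : x = 0 := by
  obtain ⟨m, rfl⟩ := hx
  simp only [eq_intCast] at h ⊢
  have : |m| < 1 := by exact_mod_cast h
  rw [Int.abs_lt_one_iff.1 this, Int.cast_zero]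

section
variable {p q : ℕ} {α : Fin p → ℝ} {β : Fin q → ℝ}

/-- A relation with integral coefficients between `1` and the series `z * ∑ moment * z ^ k` is
trivial. -/
theorem relation_trivial (hpq : p < q) (hα : ∀ i, 0 < α i) (hβ : ∀ i, 0 < β i)
    (hαβ : ∀ i j (m : ℕ), 0 < m → α i - β j ≠ m)
    (hdα : ∃ d : ℕ, 0 < d ∧ ∀ i, ∃ x : ℕ, 0 < x ∧ (d : ℝ) * α i = x)
    (hdβ : ∃ d : ℕ, 0 < d ∧ ∀ i, ∃ x : ℕ, 0 < x ∧ (d : ℝ) * β i = x)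
    {z : ℝ} (hz : z ≠ 0) (hw : ∃ g : ℕ, 0 < g ∧ (g : ℝ) * z⁻¹ ∈ intSubring)
    (c : Fin (q + 1) → ℝ) (hc : ∀ i, c i ∈ intSubring)
    (h : c 0 + ∑ j : Fin q, c j.succ * (z * ∑' k, moment α β j k * z ^ k) = 0) : c = 0 := by
  have hq : 0 < q := by omega
  obtain ⟨K, D, hK, hD, hint⟩ := exists_denominator hpq hα hβ hdα hdβ hw
  obtain ⟨E, hE, hrem⟩ := exists_remainder_bound hpq hα hβ hz
  set B := ∑ j : Fin q, |c j.succ| with hB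
  have hlim : Filter.Tendsto (fun n : ℕ => B * (K * E) * ((K * E) ^ n / n.factorial))
      Filter.atTop (nhds 0) := by
    simpa using (FloorSemiring.tendsto_pow_div_factorial_atTop (K * E)).const_mul (B * (K * E))
  obtain ⟨n, hn⟩ := ((hlim.eventually (gt_mem_nhds one_pos))).exists
  refine eq_zero_of_approximants hq (momentFunctional α β) (approxPoly α β)
    (degree_approxPoly hα hβ) (fun N t ht => ?_) (fun N => ?_) z⁻¹ n c fun s => ?_
  · refine momentFunctional_eq_zero hq hpq.le hα hβ _ _ N ?_
    simpa [Nat.div_add_mod] using ht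
  · exact momentFunctional_ne_zero hq hpq.le hα hβ hαβ N
  · set N := q * n + (s : ℕ) with hN
    have h1 : q * n ≤ N := by omega
    have h2 : N ≤ q * (n + 1) := by rw [mul_add, mul_one]; omega
    set V := c 0 * (approxPoly α β N).eval z⁻¹ +
      ∑ j, c j.succ * momentFunctional α β j (dividedDiff z⁻¹ (approxPoly α β N)) with hV
    -- Subtracting Q_N(1/z) times the assumed relation leaves only remainders.
    have hVrem : V = -∑ j, c j.succ * remainder α β z j N := by
      have h3 : ∑ j, c j.succ * remainder α β z j N = (approxPoly α β N).eval z⁻¹ *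
          (∑ j : Fin q, c j.succ * (z * ∑' k, moment α β j k * z ^ k)) -
          ∑ j, c j.succ * momentFunctional α β j (dividedDiff z⁻¹ (approxPoly α β N)) := by
        rw [Finset.mul_sum, ← Finset.sum_sub_distrib]
        exact Finset.sum_congr rfl fun j _ => by rw [remainder]; ring
      rw [h3, hV]
      linear_combination (approxPoly α β N).eval z⁻¹ * h
    obtain ⟨hQ, hP⟩ := hint n N h1 h2
    have hVint : D n * V ∈ intSubring := by
      have : D n * V = c 0 * (D n * (approxPoly α β N).eval z⁻¹) + ∑ j, c j.succ *
          (D n * momentFunctional α β j (dividedDiff z⁻¹ (approxPoly α β N))) := by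
        rw [hV, mul_add, Finset.mul_sum]
        congr 1
        · ring
        · exact Finset.sum_congr rfl fun j _ => by ring
      rw [this]
      exact add_mem (mul_mem (hc 0) hQ) (sum_mem fun j _ => mul_mem (hc _) (hP j))
    obtain ⟨hD0, hD1⟩ := hD n
    have hfac : (1 : ℝ) ≤ n.factorial := by exact_mod_cast n.factorial_pos
    have hVle : |V| ≤ B * (E ^ (n + 1) * (n.factorial : ℝ) ^ p) := by
      rw [hVrem, abs_neg, hB, Finset.sum_mul]
      refine (Finset.abs_sum_le_sum_abs _ _).trans (Finset.sum_le_sum fun j _ => ?_)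
      rw [abs_mul]
      exact mul_le_mul_of_nonneg_left (hrem j n N h1 h2) (abs_nonneg _)
    have hB0 : 0 ≤ B := Finset.sum_nonneg fun j _ => abs_nonneg _
    have hlt : |D n * V| < 1 := by
      refine lt_of_le_of_lt ?_ hn
      rw [abs_mul, abs_of_pos hD0]
      calc D n * |V| ≤ K ^ (n + 1) / (n.factorial : ℝ) ^ q *
            (B * (E ^ (n + 1) * (n.factorial : ℝ) ^ p)) := by gcongr
        _ = B * (K * E) * ((K * E) ^ n * ((n.factorial : ℝ) ^ p / (n.factorial : ℝ) ^ q)) := by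
            rw [mul_pow, pow_succ, pow_succ]; ring
        _ ≤ B * (K * E) * ((K * E) ^ n * (1 / n.factorial)) := by
            have : (n.factorial : ℝ) ^ p / (n.factorial : ℝ) ^ q ≤ 1 / n.factorial := by
              rw [div_le_div_iff₀ (by positivity) (by positivity), one_mul, ← pow_succ]
              exact pow_le_pow_right₀ hfac hpq
            exact mul_le_mul_of_nonneg_left (mul_le_mul_of_nonneg_left this (by positivity))
              (by positivity)
        _ = _ := by ring
    rcases mul_eq_zero.1 (eq_zero_of_mem_intSubring hVint hlt) with h0 | h0
    · exact absurd h0 hD0.ne'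
    · exact h0

end

/-! ### Translation to the rational parameters and conclusion -/

theorem hyperTerm_eq_moment {p q : ℕ} (a : Fin p → ℚ) (b : Fin q → ℚ) (z : ℚ) (j : Fin q) (k : ℕ) :
    hyperTerm a b z j k =
      moment (fun i => (a i : ℝ) + 1) (fun i => (b i : ℝ) + 1) j k * (z : ℝ) ^ k := by
  have h : ∏ i, risingFac ((b i : ℝ) + 1) (k + if i ≤ j then 1 else 0) =
      vecPochhammer b k * ∏ i ∈ Finset.Iic j, ((b i : ℝ) + k + 1) := by
    have h1 : ∏ i ∈ Finset.Iic j, ((b i : ℝ) + k + 1) =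
        ∏ i, if i ≤ j then ((b i : ℝ) + k + 1) else 1 := by
      rw [← Finset.prod_filter]
      congr 1
      ext i; simp
    rw [h1, vecPochhammer, ← Finset.prod_mul_distrib]
    refine Finset.prod_congr rfl fun i _ => ?_
    split_ifs
    · rw [risingFac_succ, risingFac]; ring
    · simp [risingFac]
  rw [hyperTerm, moment, h, vecPochhammer]
  simp only [risingFac]

theorem mainTheorem1 {p q : ℕ} (hpq : p < q) (a : Fin p → ℚ) (b : Fin q → ℚ) (z : ℚ)
    (ha : ∀ i, -1 < a i) (hb : ∀ j, -1 < b j)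
    (hab : ∀ i : Fin p, a i < b (Fin.castLE hpq.le i))
    (habne : ∀ (i : Fin p) (j : Fin q), (i : ℕ) ≠ (j : ℕ) → ∀ m : ℕ, a i - b j ≠ (m : ℚ))
    (hbbne : ∀ i j : Fin q, i ≠ j → ∀ m : ℕ, b i - b j ≠ (m : ℚ))
    (hz : z ≠ 0) :
    (∀ j : Fin q, Summable (hyperTerm a b z j)) ∧
    LinearIndependent ℚ (Fin.cons (1 : ℝ) (hyperConst a b z) : Fin (q + 1) → ℝ) ∧
    ∀ j : Fin q, Irrational (hyperConst a b z j) := by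
  set α : Fin p → ℝ := fun i => (a i : ℝ) + 1 with hαdef
  set β : Fin q → ℝ := fun i => (b i : ℝ) + 1 with hβdef
  have hα : ∀ i, 0 < α i := fun i => by
    have : (-1 : ℝ) < a i := by exact_mod_cast ha i
    simp only [hαdef]; linarith
  have hβ : ∀ i, 0 < β i := fun i => by
    have : (-1 : ℝ) < b i := by exact_mod_cast hb i
    simp only [hβdef]; linarith
  have hαβ : ∀ i j (m : ℕ), 0 < m → α i - β j ≠ m := by
    intro i j m hm h
    have h' : a i - b j = (m : ℚ) := by
      have : (a i : ℝ) - b j = m := by rw [← h, hαdef, hβdef]; ring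
      exact_mod_cast this
    -- On the diagonal a_i < b_i rules out a positive difference; off it `habne` applies.
    by_cases hij : (i : ℕ) = j
    · have hj : j = Fin.castLE hpq.le i := Fin.ext hij.symm
      have h1 := hab i
      rw [← hj] at h1
      have : (0 : ℚ) < m := by exact_mod_cast hm
      linarith
    · exact habne i j hij m h'
  have hdα : ∃ d : ℕ, 0 < d ∧ ∀ i, ∃ x : ℕ, 0 < x ∧ (d : ℝ) * α i = x := by
    simpa [hαdef] using exists_common_denominator_of_pos (fun i => a i + 1)
      fun i => by linarith [ha i]
  have hdβ : ∃ d : ℕ, 0 < d ∧ ∀ i, ∃ x : ℕ, 0 < x ∧ (d : ℝ) * β i = x := by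
    simpa [hβdef] using exists_common_denominator_of_pos (fun i => b i + 1)
      fun i => by linarith [hb i]
  have hzR : (z : ℝ) ≠ 0 := by exact_mod_cast hz
  have hw : ∃ g : ℕ, 0 < g ∧ (g : ℝ) * (z : ℝ)⁻¹ ∈ intSubring := by
    obtain ⟨g, hg, h⟩ := exists_common_denominator fun _ : Unit => z⁻¹
    obtain ⟨x, hx⟩ := h ()
    refine ⟨g, hg, ?_⟩
    push_cast at hx
    rw [hx]
    exact intCast_mem_intSubring x
  have hterm : ∀ j, hyperTerm a b z j = fun k => moment α β j k * (z : ℝ) ^ k :=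
    fun j => funext (hyperTerm_eq_moment a b z j)
  have hconst : ∀ j, hyperConst a b z j = ∑' k, moment α β j k * (z : ℝ) ^ k :=
    fun j => by rw [hyperConst, hterm]
  have hli : LinearIndependent ℚ (Fin.cons (1 : ℝ) (hyperConst a b z) : Fin (q + 1) → ℝ) := by
    rw [Fintype.linearIndependent_iff]
    intro g hg
    -- `relation_trivial` concerns z·f_j, so the relation is multiplied by z, which changes only the
    -- constant coefficient.
    let r : Fin (q + 1) → ℚ := Fin.cons (g 0 * z) fun j => g j.succ
    obtain ⟨G, hG, hGr⟩ := exists_common_denominator r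
    have hG' : (G : ℝ) ≠ 0 := by exact_mod_cast hG.ne'
    have hzero := relation_trivial hpq hα hβ hαβ hdα hdβ hzR hw (fun i => (G : ℝ) * r i)
      (fun i => by
        obtain ⟨x, hx⟩ := hGr i
        rw [hx]
        exact intCast_mem_intSubring x) (by
        rw [Fin.sum_univ_succ] at hg
        simp only [Fin.cons_zero, Fin.cons_succ, Rat.smul_def, mul_one, hconst] at hg
        simp only [r, Fin.cons_zero, Fin.cons_succ]
        have h1 := congr_arg (fun t => (G : ℝ) * z * t) hg
        simp only [mul_add, Finset.mul_sum, mul_zero] at h1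
        rw [← h1]
        push_cast
        congr 1
        · ring
        · exact Finset.sum_congr rfl fun j _ => by ring)
    have hr : ∀ i, r i = 0 := fun i => by
      have := congr_fun hzero i
      simpa [hG'] using this
    intro i
    refine Fin.cases ?_ (fun j => ?_) i
    · have := hr 0
      simpa [r, hz] using this
    · simpa [r] using hr j.succ
  refine ⟨fun j => ?_, hli, fun j => ?_⟩
  · rw [hterm]
    exact summable_moment hpq hα hβ j z
  · rintro ⟨x, hx⟩
    -- A rational sum x would give the nontrivial relation x·1 − f_j = 0.
    have h0 := Fintype.linearIndependent_iff.1 hli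
      (Fin.cons x fun i => if i = j then -1 else 0) (by
        rw [Fin.sum_univ_succ]
        simp [Rat.smul_def, hx]) j.succ
    simp at h0
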